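/- Let $a\in\mathbb R$, $T>0$, $\alpha\in(0,\infty)\setminus\mathbb N$, and let $y\in C^{\lceil\alpha\rceil}[a,a+T]$ be real-valued. Put $q_{\mathrm D}=\alpha-\lceil\alpha\rceil+1\in(0,1)$ and, for $w\in\mathbb R$ and $t\in[a,a+T]$, \[ \phi^{\mathrm D}(w,t)=(-1)^{\lfloor\alpha\rfloor}\,\frac{\sin\alpha\pi}{\pi}\,\mathrm e^{wq_{\mathrm D}}\int_a^t y^{(\lceil\alpha\rceil)}(\tau)\exp\bigl(-(t-\tau)\mathrm e^{w}\bigr)\,\mathrm d\tau , \] and, for $u\ge 0$, \[ \hat\phi^{\mathrm D}(u,t)=\mathrm e^{u}\left(\frac1{q_{\mathrm D}}\,\phi^{\mathrm D}\Bigl(-\frac{u}{q_{\mathrm D}},t\Bigr)+\frac1{1-q_{\mathrm D}}\,\phi^{\mathrm D}\Bigl(\frac{u}{1-q_{\mathrm D}},t\Bigr)\right). \] Let $D_a^\alpha y$ denote the Caputo derivative of order $\alpha$ with starting point $a$, \[ D_a^\alpha y(t)=\frac1{\Gamma(\lceil\alpha\rceil-\alpha)}\int_a^t (t-\tau)^{\lceil\alpha\rceil-\alpha-1}\,y^{(\lceil\alpha\rceil)}(\tau)\,\mathrm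 d\tau ,\qquad t\in[a,a+T]. \] For $K\ge 1$ let $Q_K^{\mathrm{GLa}}[f]=\sum_{k=1}^K a_k^{\mathrm{GLa}} f(x_k^{\mathrm{GLa}})$ be the $K$-point Gauss--Laguerre quadrature formula, i.e. the Gaussian quadrature formula for the weight function $\mathrm e^{-u}$ on $[0,\infty)$: its nodes are the zeros of the Laguerre polynomial $L_K(x)=\sum_{k=0}^K(-1)^k\binom Kk\frac{x^k}{k!}$, and its weights are the integrals over $[0,\infty)$ of $\mathrm e^{-u}$ times the Lagrange basis polynomials of these nodes. Then, for all $t\in[a,a+T]$, \[ \lim_{K\to\infty}Q_K^{\mathrm{GLa}}\bigl[\hat\phi^{\mathrm D}(\cdot,t)\bigr]=D_a^\alpha y(t). \] -/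

import Mathlib

open Filter Topology MeasureTheory

noncomputable section

/-- The derivative `y^(⌈α⌉)` of a function `y` on the compact interval `[a, a + T]`
(one-sided at the end points). -/
def topDeriv (α a T : ℝ) (y : ℝ → ℝ) (τ : ℝ) : ℝ :=
  iteratedDerivWithin ⌈α⌉₊ y (Set.Icc a (a + T)) τ

/-- The Caputo derivative of order `α` with starting point `a` of a function `y` on `[a, a + T]`:
the Riemann-Liouville integral of order `⌈α⌉ - α`, starting at `a`, of `y^(⌈α⌉)`. -/
def caputoDeriv (α a T : ℝ) (y : ℝ → ℝ) (t : ℝ) : ℝ :=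
  (1 / Real.Gamma (⌈α⌉₊ - α)) *
    ∫ τ in a..t, (t - τ) ^ ((⌈α⌉₊ : ℝ) - α - 1) * topDeriv α a T y τ

/-- `q_D = α - ⌈α⌉ + 1`. -/
def qD (α : ℝ) : ℝ := α - ⌈α⌉₊ + 1

/-- The integrand `φ^D(w, t)` of the diffusive representation. -/
def phiD (α a T : ℝ) (y : ℝ → ℝ) (w t : ℝ) : ℝ :=
  (-1) ^ ⌊α⌋₊ * (Real.sin (α * Real.pi) / Real.pi) * Real.exp (w * qD α) *
    ∫ τ in a..t, topDeriv α a T y τ * Real.exp (-(t - τ) * Real.exp w)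

/-- The transformed integrand on the half line. -/
def phiHat (α a T : ℝ) (y : ℝ → ℝ) (u t : ℝ) : ℝ :=
  Real.exp u * (1 / qD α * phiD α a T y (-u / qD α) t +
    1 / (1 - qD α) * phiD α a T y (u / (1 - qD α)) t)

/-- The Laguerre polynomial of degree `K`, which is orthonormal for the weight `e^{-x}`
on `[0, ∞)`: `L_K(x) = ∑_{k ≤ K} (-1)^k (K choose k) x^k / k!`. -/
def laguerre (K : ℕ) : Polynomial ℝ :=
  ∑ k ∈ Finset.range (K + 1),
    Polynomial.monomial k ((-1 : ℝ) ^ k * (K.choose k : ℝ) / (k.factorial : ℝ))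

/-- The nodes of the `K`-point Gauss-Laguerre formula: the zeros of `L_K`. -/
def gaussLaguerreNodes (K : ℕ) : Finset ℝ := (laguerre K).roots.toFinset

/-- The weight of the `K`-point Gauss-Laguerre formula at the node `x`: the integral of the
Lagrange basis polynomial of `x` against the weight function `e^{-u}` on `[0, ∞)`. -/
def gaussLaguerreWeight (K : ℕ) (x : ℝ) : ℝ :=
  ∫ u in Set.Ioi (0 : ℝ), Real.exp (-u) * (Lagrange.basis (gaussLaguerreNodes K) id x).eval u

/-- The `K`-point Gauss-Laguerre quadrature formula. -/
def gaussLaguerre (K : ℕ) (f : ℝ → ℝ) : ℝ :=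
  ∑ x ∈ gaussLaguerreNodes K, gaussLaguerreWeight K x * f x

end

/-! ### Gauss–Laguerre formulas: simple positive nodes, exactness, nonnegative weights. -/

section LaguerreQuadrature

open Polynomial Set

/-! Two independent facts combine. First, the integral of `e^{-u} φ̂(u, t)` over the half line is
exactly the Caputo derivative. The factor `e^u` cancels the weight, and the two summands of `φ̂` are
the rescaled halves of the integral of `φ` over the real line (`integral_Ioi_split_scaled`). By
Fubini and the substitution `v = e^w` in the Gamma integral, that integral is the kernel `(t -
τ)^{-q_D}` integrated against the top derivative (`integral_exp_mul_truncatedLaplace`); the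
reflection formula settles the constant (`diffusive_constant`).

Second, `φ̂(·, t)` is continuous and bounded, and Gauss–Laguerre quadrature converges for every such
function (`GaussLaguerreConverges.of_bounded`). Exactness on polynomials and nonnegative weights let
convergence pass to functions with a majorant of small integral for the approximation error
(`of_approx`). Taylor expansion carries it from polynomials to powers of `e^{-u}`, and Weierstrass
approximation in `z = e^{-u}` to bounded continuous functions. -/

lemma integral_exp_neg_mul_pow (n : ℕ) :
    ∫ u in Ioi (0 : ℝ), Real.exp (-u) * u ^ n = n.factorial := by
  rw [← Real.Gamma_nat_eq_factorial, Real.Gamma_eq_integral (by positivity)]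
  simp

lemma integrableOn_exp_neg_mul_pow (n : ℕ) :
    IntegrableOn (fun u : ℝ => Real.exp (-u) * u ^ n) (Ioi 0) := by
  simpa using Real.GammaIntegral_convergent (s := n + 1) (by positivity)

lemma integrableOn_exp_neg_mul_eval (p : ℝ[X]) :
    IntegrableOn (fun u : ℝ => Real.exp (-u) * p.eval u) (Ioi 0) := by
  induction p using Polynomial.induction_on' with
  | add p q hp hq =>
    simp only [eval_add, mul_add]
    exact Integrable.add hp hq
  | monomial n c =>
    simp only [eval_monomial, mul_left_comm _ c]
    exact Integrable.const_mul (integrableOn_exp_neg_mul_pow n) c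

/-- The functional `p ↦ ∫₀^∞ e^{-u} p(u) du` on polynomials. -/
noncomputable def expMoment : ℝ[X] →ₗ[ℝ] ℝ where
  toFun p := ∫ u in Ioi (0 : ℝ), Real.exp (-u) * p.eval u
  map_add' p q := by
    simp only [eval_add, mul_add]
    exact integral_add (integrableOn_exp_neg_mul_eval p) (integrableOn_exp_neg_mul_eval q)
  map_smul' c p := by
    simp only [eval_smul, smul_eq_mul, mul_left_comm _ c, RingHom.id_apply]
    exact integral_const_mul _ _

lemma expMoment_apply (p : ℝ[X]) :
    expMoment p = ∫ u in Ioi (0 : ℝ), Real.exp (-u) * p.eval u := rfl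

lemma expMoment_monomial (n : ℕ) (c : ℝ) : expMoment (monomial n c) = c * n.factorial := by
  simp only [expMoment_apply, eval_monomial, mul_left_comm _ c, integral_const_mul,
    integral_exp_neg_mul_pow]

lemma expMoment_nonneg {p : ℝ[X]} (hp : ∀ u, 0 < u → 0 ≤ p.eval u) : 0 ≤ expMoment p :=
  setIntegral_nonneg measurableSet_Ioi fun u hu => mul_nonneg (Real.exp_pos _).le (hp u hu)

lemma eq_zero_of_expMoment_eq_zero {p : ℝ[X]} (hp : ∀ u, 0 < u → 0 ≤ p.eval u)
    (h : expMoment p = 0) : p = 0 := by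
  rw [expMoment_apply, setIntegral_eq_zero_iff_of_nonneg_ae
    ((ae_restrict_iff' measurableSet_Ioi).2 (ae_of_all _ fun u hu =>
      mul_nonneg (Real.exp_pos _).le (hp u hu))) (integrableOn_exp_neg_mul_eval p)] at h
  have hz : EqOn (fun u : ℝ => Real.exp (-u) * p.eval u) 0 (Ioi 0) :=
    Measure.eqOn_open_of_ae_eq (μ := volume) h isOpen_Ioi
      (Continuous.continuousOn (by fun_prop)) continuousOn_const
  refine Polynomial.eq_zero_of_infinite_isRoot p ((Ioi_infinite (0 : ℝ)).mono fun u hu => ?_)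
  have := hz hu
  simpa [Real.exp_ne_zero] using this

/-- Up to sign, this sum is the `K`-th forward difference of `P` at `0`. -/
lemma sum_neg_one_pow_choose_mul_eval_eq_zero {K : ℕ} {P : ℝ[X]} (hP : P.natDegree < K) :
    ∑ k ∈ Finset.range (K + 1), (-1 : ℝ) ^ k * K.choose k * P.eval (k : ℝ) = 0 := by
  have h := congrFun (Polynomial.fwdDiff_iter_eq_zero_of_degree_lt hP) 0
  rw [fwdDiff_iter_eq_sum_shift] at h
  have h2 := congrArg (fun z : ℝ => (-1) ^ K * z) h
  simp only [Pi.zero_apply, mul_zero, Finset.mul_sum] at h2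
  rw [← h2]
  refine Finset.sum_congr rfl fun k hk => ?_
  have hk' : k ≤ K := by simpa [Nat.lt_succ_iff] using hk
  obtain ⟨j, rfl⟩ := Nat.exists_eq_add_of_le hk'
  have hj : ((-1 : ℝ) ^ j) * (-1) ^ j = 1 := by rw [← mul_pow]; simp
  simp only [zsmul_eq_mul, Nat.add_sub_cancel_left, pow_add, nsmul_eq_mul, zero_add, mul_one]
  push_cast
  linear_combination (-(-1 : ℝ) ^ k * ((k + j).choose k) * P.eval (k : ℝ)) * hj

lemma expMoment_laguerre_mul_X_pow {K m : ℕ} (hm : m < K) :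
    expMoment (laguerre K * X ^ m) = 0 := by
  -- The moment produces `(k + m)! / k! = (k + 1) ⋯ (k + m)`, a polynomial in `k` of degree `m < K`,
  -- so the `K`-th difference kills it.
  let P : ℝ[X] := (ascPochhammer ℝ m).comp (X + C 1)
  have hP : P.natDegree < K := by
    rw [natDegree_comp, ascPochhammer_natDegree, natDegree_X_add_C, mul_one]
    exact hm
  rw [laguerre, Finset.sum_mul, map_sum, ← sum_neg_one_pow_choose_mul_eval_eq_zero hP]
  refine Finset.sum_congr rfl fun k _ => ?_
  rw [monomial_mul_X_pow, expMoment_monomial]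
  have h : P.eval (k : ℝ) = ((k + 1).ascFactorial m : ℕ) := by
    rw [← ascPochhammer_nat_eq_ascFactorial, ascPochhammer_eval_cast]
    simp [P]
  rw [h, ← Nat.factorial_mul_ascFactorial]
  have : (k.factorial : ℝ) ≠ 0 := by positivity
  push_cast
  field_simp

lemma expMoment_laguerre_mul {K : ℕ} {q : ℝ[X]} (hq : q.degree < K) :
    expMoment (laguerre K * q) = 0 := by
  by_cases h0 : q = 0
  · simp [h0]
  have hq' : q.natDegree < K := (natDegree_lt_iff_degree_lt h0).2 hq
  rw [q.as_sum_range_C_mul_X_pow, Finset.mul_sum, map_sum]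
  refine Finset.sum_eq_zero fun m hm => ?_
  rw [mul_left_comm, ← smul_eq_C_mul, map_smul, expMoment_laguerre_mul_X_pow, smul_zero]
  simp at hm
  omega

lemma laguerre_coeff_self (K : ℕ) : (laguerre K).coeff K = (-1) ^ K / K.factorial := by
  simp [laguerre, coeff_monomial]

lemma laguerre_degree (K : ℕ) : (laguerre K).degree = K := by
  refine le_antisymm ?_ (le_degree_of_ne_zero ?_)
  · refine (degree_sum_le _ _).trans (Finset.sup_le fun k hk => (degree_monomial_le _ _).trans ?_)
    simp at hk
    exact_mod_cast hk
  · rw [laguerre_coeff_self]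
    positivity

lemma laguerre_ne_zero (K : ℕ) : laguerre K ≠ 0 := by
  intro h
  have := laguerre_degree K
  simp [h] at this

/-- Every real polynomial acquires a constant sign on `(0, ∞)` when multiplied by the product
of the linear factors at suitable positive roots. -/
lemma exists_positive_roots_mul_constant_sign (n : ℕ) :
    ∀ P : ℝ[X], P.natDegree = n → P ≠ 0 → ∃ S : Finset ℝ, (∀ r ∈ S, 0 < r ∧ P.IsRoot r) ∧
      ((∀ u, 0 < u → 0 ≤ (P * ∏ r ∈ S, (X - C r)).eval u) ∨
        ∀ u, 0 < u → (P * ∏ r ∈ S, (X - C r)).eval u ≤ 0) := by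
  induction n with
  | zero =>
    intro P hP _
    refine ⟨∅, by simp, ?_⟩
    rw [eq_C_of_natDegree_eq_zero hP]
    rcases le_total 0 (P.coeff 0) with h | h
    · left; simpa using fun _ _ => h
    · right; simpa using fun _ _ => h
  | succ n ih =>
    intro P hP hP0
    by_cases hroot : ∃ r, 0 < r ∧ P.IsRoot r
    · obtain ⟨r, hr, hPr⟩ := hroot
      obtain ⟨Q, rfl⟩ := dvd_iff_isRoot.2 hPr
      have hQ0 : Q ≠ 0 := right_ne_zero_of_mul hP0
      have hQ : Q.natDegree = n := by
        rw [natDegree_mul (X_sub_C_ne_zero r) hQ0, natDegree_X_sub_C] at hP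
        omega
      obtain ⟨S, hS, hsign⟩ := ih Q hQ hQ0
      have hmem : ∀ s ∈ S, 0 < s ∧ ((X - C r) * Q).IsRoot s := fun s hs =>
        ⟨(hS s hs).1, by simp [IsRoot.def, (hS s hs).2.eq_zero]⟩
      -- The factor `X - r` of `P` replaces the one in the product if `r` was already used for `Q`;
      -- otherwise a second copy is added to make a square.
      by_cases hrS : r ∈ S
      · refine ⟨S.erase r, fun s hs => hmem s (Finset.mem_of_mem_erase hs), ?_⟩
        have : (X - C r) * Q * ∏ s ∈ S.erase r, (X - C s) = Q * ∏ s ∈ S, (X - C s) := by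
          rw [← Finset.mul_prod_erase S _ hrS]; ring
        rwa [this]
      · refine ⟨insert r S, ?_, ?_⟩
        · intro s hs
          rcases Finset.mem_insert.1 hs with rfl | hs
          · exact ⟨hr, hPr⟩
          · exact hmem s hs
        · have : ∀ u, ((X - C r) * Q * ∏ s ∈ insert r S, (X - C s)).eval u =
              (u - r) ^ 2 * (Q * ∏ s ∈ S, (X - C s)).eval u := by
            intro u
            rw [Finset.prod_insert hrS]
            simp only [eval_mul, eval_sub, eval_X, eval_C]
            ring
          simp only [this]
          exact hsign.imp (fun h u hu => mul_nonneg (sq_nonneg _) (h u hu))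
            (fun h u hu => mul_nonpos_of_nonneg_of_nonpos (sq_nonneg _) (h u hu))
    · push Not at hroot
      refine ⟨∅, by simp, ?_⟩
      simp only [Finset.prod_empty, mul_one]
      by_contra! h
      obtain ⟨⟨u, hu, hPu⟩, v, hv, hPv⟩ := h
      have := isPreconnected_Ioi.intermediate_value (mem_Ioi.2 hu) (mem_Ioi.2 hv)
        (f := fun x => P.eval x) P.continuous.continuousOn
      obtain ⟨x, hx, hPx⟩ := this ⟨hPu.le, hPv.le⟩
      exact hroot x hx hPx

lemma mem_gaussLaguerreNodes {K : ℕ} {x : ℝ} :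
    x ∈ gaussLaguerreNodes K ↔ (laguerre K).IsRoot x := by
  simp [gaussLaguerreNodes, laguerre_ne_zero]

/-- With fewer than `K` positive roots in `S`, the product of `L_K` with their linear factors would
have constant sign on `(0, ∞)` and, by orthogonality, zero integral, hence vanish. -/
lemma exists_positive_subset_nodes (K : ℕ) :
    ∃ S ⊆ gaussLaguerreNodes K, (∀ r ∈ S, 0 < r) ∧ K ≤ S.card := by
  obtain ⟨S, hS, hsign⟩ :=
    exists_positive_roots_mul_constant_sign _ (laguerre K) rfl (laguerre_ne_zero K)
  refine ⟨S, fun r hr => mem_gaussLaguerreNodes.2 (hS r hr).2, fun r hr => (hS r hr).1, ?_⟩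
  by_contra! hcard
  have hdeg : (∏ r ∈ S, (X - C r) : ℝ[X]).degree < (K : WithBot ℕ) := by
    rw [degree_prod]
    simpa using hcard
  have hzero := expMoment_laguerre_mul hdeg
  have hne : laguerre K * ∏ r ∈ S, (X - C r) ≠ 0 :=
    mul_ne_zero (laguerre_ne_zero K) (Finset.prod_ne_zero_iff.2 fun r _ => X_sub_C_ne_zero r)
  rcases hsign with h | h
  · exact hne (eq_zero_of_expMoment_eq_zero h hzero)
  · refine hne (neg_eq_zero.1 (eq_zero_of_expMoment_eq_zero (fun u hu => ?_) ?_))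
    · simpa only [eval_neg, Left.nonneg_neg_iff] using h u hu
    · rw [map_neg, hzero, neg_zero]

lemma card_gaussLaguerreNodes_le (K : ℕ) : (gaussLaguerreNodes K).card ≤ K := by
  refine (Multiset.toFinset_card_le _).trans ((card_roots' _).trans_eq ?_)
  exact natDegree_eq_of_degree_eq_some (laguerre_degree K)

lemma card_gaussLaguerreNodes (K : ℕ) : (gaussLaguerreNodes K).card = K := by
  obtain ⟨S, hS, -, hK⟩ := exists_positive_subset_nodes K
  exact le_antisymm (card_gaussLaguerreNodes_le K) (hK.trans (Finset.card_le_card hS))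

lemma gaussLaguerreNodes_pos {K : ℕ} {x : ℝ} (hx : x ∈ gaussLaguerreNodes K) : 0 < x := by
  obtain ⟨S, hS, hpos, hK⟩ := exists_positive_subset_nodes K
  rw [← Finset.eq_of_subset_of_card_le hS ((card_gaussLaguerreNodes_le K).trans hK)] at hx
  exact hpos x hx

lemma gaussLaguerre_eval_of_degree_lt {K : ℕ} {p : ℝ[X]} (hp : p.degree < K) :
    gaussLaguerre K (fun u => p.eval u) = expMoment p := by
  have h := Lagrange.eq_interpolate (s := gaussLaguerreNodes K) (v := id)
    (Set.injOn_id _) (f := p) (by rwa [card_gaussLaguerreNodes])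
  conv_rhs => rw [h, Lagrange.interpolate_apply, map_sum]
  refine Finset.sum_congr rfl fun x _ => ?_
  rw [← smul_eq_C_mul, map_smul, smul_eq_mul, mul_comm]
  rfl

/-- The `K`-point Gauss-Laguerre formula is exact for polynomials of degree less than `2K`. -/
lemma gaussLaguerre_eval {K : ℕ} {p : ℝ[X]} (hp : p.natDegree < 2 * K) :
    gaussLaguerre K (fun u => p.eval u) = expMoment p := by
  have hL := laguerre_ne_zero K
  have hr : (p % laguerre K).degree < K := by
    rw [← laguerre_degree K]
    exact EuclideanDomain.mod_lt p hL
  have hq : (p / laguerre K).degree < K := by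
    by_cases h0 : p / laguerre K = 0
    · simp [h0]
    · have hle : (laguerre K).degree ≤ p.degree :=
        not_lt.1 fun h => h0 ((Polynomial.div_eq_zero_iff hL).2 h)
      have hadd := degree_add_div hL hle
      have hp0 : p ≠ 0 := fun h => h0 (by simp [h])
      rw [laguerre_degree, degree_eq_natDegree h0, degree_eq_natDegree hp0] at hadd
      rw [← natDegree_lt_iff_degree_lt h0]
      have : K + (p / laguerre K).natDegree = p.natDegree := by exact_mod_cast hadd
      omega
  have hdecomp := EuclideanDomain.div_add_mod p (laguerre K)
  calc gaussLaguerre K (fun u => p.eval u)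
      = gaussLaguerre K (fun u => (p % laguerre K).eval u) := by
        refine Finset.sum_congr rfl fun x hx => ?_
        conv_lhs => rw [← hdecomp]
        simp [(mem_gaussLaguerreNodes.1 hx).eq_zero]
    _ = expMoment (p % laguerre K) := gaussLaguerre_eval_of_degree_lt hr
    _ = expMoment p := by
        conv_rhs => rw [← hdecomp, map_add, expMoment_laguerre_mul hq, zero_add]

/-- The squared Lagrange basis polynomial has degree `2K - 2`, so the formula is exact for it; only
the node `x` contributes, and the integral is nonnegative. -/
lemma gaussLaguerreWeight_nonneg {K : ℕ} {x : ℝ} (hx : x ∈ gaussLaguerreNodes K) :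
    0 ≤ gaussLaguerreWeight K x := by
  let B := Lagrange.basis (gaussLaguerreNodes K) id x
  have hinj : Set.InjOn (id : ℝ → ℝ) (gaussLaguerreNodes K) := Set.injOn_id _
  have hB : B.natDegree = K - 1 := by
    simpa [card_gaussLaguerreNodes] using Lagrange.natDegree_basis hinj hx
  have hK : 0 < K := by
    rw [← card_gaussLaguerreNodes K]
    exact Finset.card_pos.2 ⟨x, hx⟩
  have hdeg : (B ^ 2).natDegree < 2 * K := by
    rw [natDegree_pow, hB]
    omega
  have hex := gaussLaguerre_eval hdeg
  have hsum : gaussLaguerre K (fun u => (B ^ 2).eval u) = gaussLaguerreWeight K x := by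
    rw [gaussLaguerre, Finset.sum_eq_single x]
    · have : B.eval x = 1 := Lagrange.eval_basis_self hinj hx
      simp [this]
    · intro z hz hzx
      have : B.eval z = 0 := Lagrange.eval_basis_of_ne (v := id) hzx.symm hz
      simp [this]
    · exact fun h => absurd hx h
  rw [← hsum, hex]
  exact expMoment_nonneg fun u _ => by rw [eval_pow]; positivity

end LaguerreQuadrature

/-! ### Convergence of the quadrature for bounded continuous functions. -/

section LaguerreConvergence

open Polynomial Set

lemma gaussLaguerre_add (K : ℕ) (f g : ℝ → ℝ) :
    gaussLaguerre K (fun u => f u + g u) = gaussLaguerre K f + gaussLaguerre K g := by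
  simp [gaussLaguerre, mul_add, Finset.sum_add_distrib]

lemma gaussLaguerre_const_mul (K : ℕ) (c : ℝ) (f : ℝ → ℝ) :
    gaussLaguerre K (fun u => c * f u) = c * gaussLaguerre K f := by
  simp [gaussLaguerre, Finset.mul_sum, mul_left_comm]

lemma abs_gaussLaguerre_sub_le {K : ℕ} {f g h : ℝ → ℝ} (hfg : ∀ u, 0 < u → |f u - g u| ≤ h u) :
    |gaussLaguerre K f - gaussLaguerre K g| ≤ gaussLaguerre K h := by
  simp only [gaussLaguerre, ← Finset.sum_sub_distrib, ← mul_sub]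
  refine (Finset.abs_sum_le_sum_abs _ _).trans (Finset.sum_le_sum fun x hx => ?_)
  rw [abs_mul, abs_of_nonneg (gaussLaguerreWeight_nonneg hx)]
  exact mul_le_mul_of_nonneg_left (hfg x (gaussLaguerreNodes_pos hx))
    (gaussLaguerreWeight_nonneg hx)

/-- `f` is integrable for the weight `e^{-u}` on `(0, ∞)` and the Gauss-Laguerre formulas applied
to `f` converge to the weighted integral. -/
def GaussLaguerreConverges (f : ℝ → ℝ) : Prop :=
  IntegrableOn (fun u => Real.exp (-u) * f u) (Ioi 0) ∧
    Tendsto (fun K => gaussLaguerre K f) atTop (𝓝 (∫ u in Ioi (0 : ℝ), Real.exp (-u) * f u))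

namespace GaussLaguerreConverges

lemma add {f g : ℝ → ℝ} (hf : GaussLaguerreConverges f) (hg : GaussLaguerreConverges g) :
    GaussLaguerreConverges fun u => f u + g u := by
  simp only [GaussLaguerreConverges, mul_add, gaussLaguerre_add]
  refine ⟨Integrable.add hf.1 hg.1, ?_⟩
  rw [integral_add hf.1 hg.1]
  exact hf.2.add hg.2

lemma const_mul {f : ℝ → ℝ} (c : ℝ) (hf : GaussLaguerreConverges f) :
    GaussLaguerreConverges fun u => c * f u := by
  simp only [GaussLaguerreConverges, mul_left_comm _ c, gaussLaguerre_const_mul,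
    integral_const_mul]
  exact ⟨Integrable.const_mul hf.1 c, hf.2.const_mul c⟩

lemma polynomial (p : ℝ[X]) : GaussLaguerreConverges fun u => p.eval u := by
  refine ⟨integrableOn_exp_neg_mul_eval p, tendsto_const_nhds.congr' ?_⟩
  filter_upwards [eventually_gt_atTop p.natDegree] with K hK
  exact (gaussLaguerre_eval (by omega)).symm

lemma sum {ι : Type*} (s : Finset ι) {f : ι → ℝ → ℝ}
    (hf : ∀ i ∈ s, GaussLaguerreConverges (f i)) :
    GaussLaguerreConverges fun u => ∑ i ∈ s, f i u := by
  classical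
  induction s using Finset.induction_on with
  | empty => simpa using polynomial 0
  | insert i s hi ih =>
    simp only [Finset.sum_insert hi]
    exact (hf i (Finset.mem_insert_self i s)).add
      (ih fun j hj => hf j (Finset.mem_insert_of_mem hj))

/-- Replacing `f` by `g` costs at most the integral of `h` in the limit, both in the integral and,
by positivity of the formula, in the quadrature. -/
lemma of_approx {f : ℝ → ℝ} (hf : ContinuousOn f (Ioi 0))
    (happ : ∀ ε > 0, ∃ g h : ℝ → ℝ, GaussLaguerreConverges g ∧ GaussLaguerreConverges h ∧
      (∀ u, 0 < u → |f u - g u| ≤ h u) ∧ ∫ u in Ioi (0 : ℝ), Real.exp (-u) * h u < ε) :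
    GaussLaguerreConverges f := by
  have hint : IntegrableOn (fun u => Real.exp (-u) * f u) (Ioi 0) := by
    obtain ⟨g, h, hg, hh, hle, -⟩ := happ 1 one_pos
    refine (Integrable.add hg.1.norm hh.1).mono'
      (ContinuousOn.aestronglyMeasurable
        ((Continuous.continuousOn (by fun_prop)).mul hf) measurableSet_Ioi) ?_
    refine (ae_restrict_iff' measurableSet_Ioi).2 (ae_of_all _ fun u hu => ?_)
    have h1 : |f u| ≤ |g u| + h u := by
      have := abs_sub_abs_le_abs_sub (f u) (g u)
      linarith [hle u hu]
    simp only [norm_mul, Real.norm_eq_abs, Real.abs_exp, Pi.add_apply, ← mul_add]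
    exact mul_le_mul_of_nonneg_left h1 (Real.exp_pos _).le
  refine ⟨hint, Metric.tendsto_atTop.2 fun ε hε => ?_⟩
  obtain ⟨g, h, hg, hh, hle, hsmall⟩ := happ (ε / 3) (by positivity)
  have hI : |(∫ u in Ioi (0 : ℝ), Real.exp (-u) * f u) -
      ∫ u in Ioi (0 : ℝ), Real.exp (-u) * g u| ≤ ∫ u in Ioi (0 : ℝ), Real.exp (-u) * h u := by
    rw [← integral_sub hint hg.1, ← Real.norm_eq_abs]
    refine norm_integral_le_of_norm_le hh.1 ?_
    refine (ae_restrict_iff' measurableSet_Ioi).2 (ae_of_all _ fun u hu => ?_)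
    rw [← mul_sub, norm_mul, Real.norm_eq_abs, Real.norm_eq_abs, Real.abs_exp]
    exact mul_le_mul_of_nonneg_left (hle u hu) (Real.exp_pos _).le
  obtain ⟨N, hN⟩ := eventually_atTop.1 ((Metric.tendsto_nhds.1 hg.2 (ε / 3) (by positivity)).and
    (hh.2.eventually_lt_const hsmall))
  refine ⟨N, fun K hK => ?_⟩
  obtain ⟨hgK, hhK⟩ := hN K hK
  have hQ := abs_gaussLaguerre_sub_le (K := K) hle
  rw [Real.dist_eq] at hgK ⊢
  rw [abs_le] at hI hQ
  rw [abs_lt] at hgK ⊢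
  constructor <;> linarith [hI.1, hI.2, hQ.1, hQ.2, hgK.1, hgK.2]

end GaussLaguerreConverges

/-- The derivative of each Taylor remainder is minus the preceding one, so the bound integrates up
by induction. -/
lemma abs_exp_neg_sub_sum_le (m : ℕ) :
    ∀ x : ℝ, 0 ≤ x → |Real.exp (-x) - ∑ j ∈ Finset.range m, (-x) ^ j / j.factorial| ≤
      x ^ m / m.factorial := by
  induction m with
  | zero =>
    intro x hx
    simpa using hx
  | succ m ih =>
    intro x hx
    let R : ℝ → ℝ := fun x => Real.exp (-x) - ∑ j ∈ Finset.range (m + 1), (-x) ^ j / j.factorial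
    let R' : ℝ → ℝ := fun x => -(Real.exp (-x) - ∑ j ∈ Finset.range m, (-x) ^ j / j.factorial)
    have hderiv : ∀ z, HasDerivAt R (R' z) z := by
      intro z
      have hs : HasDerivAt (fun x : ℝ => ∑ j ∈ Finset.range (m + 1), (-x) ^ j / j.factorial)
          (∑ j ∈ Finset.range (m + 1), (j * (-z) ^ (j - 1) * (-1)) / j.factorial) z :=
        HasDerivAt.fun_sum fun j _ => (((hasDerivAt_neg z).pow j).div_const _)
      convert! (hasDerivAt_neg z).exp.sub hs using 1
      rw [Finset.sum_range_succ']
      simp only [R', Nat.cast_zero, zero_mul, zero_div, add_zero, Nat.add_sub_cancel]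
      have : ∀ j : ℕ, (((j + 1 : ℕ) : ℝ) * (-z) ^ j * (-1)) / (j + 1).factorial =
          -((-z) ^ j / j.factorial) := by
        intro j
        have : (j.factorial : ℝ) ≠ 0 := by positivity
        rw [Nat.factorial_succ]
        push_cast
        field_simp
      simp only [this, Finset.sum_neg_distrib]
      ring
    have hB : ∀ z : ℝ, HasDerivAt (fun x : ℝ => x ^ (m + 1) / (m + 1).factorial)
        (z ^ m / m.factorial) z := by
      intro z
      convert! (hasDerivAt_pow (m + 1) z).div_const ((m + 1).factorial : ℝ) using 1
      have : (m.factorial : ℝ) ≠ 0 := by positivity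
      rw [Nat.factorial_succ]
      push_cast
      field_simp
    have key := image_norm_le_of_norm_deriv_right_le_deriv_boundary (f := R) (f' := R')
      (a := 0) (b := x) (B := fun x : ℝ => x ^ (m + 1) / (m + 1).factorial)
      (B' := fun z => z ^ m / m.factorial)
      (fun z _ => (hderiv z).continuousAt.continuousWithinAt)
      (fun z _ => (hderiv z).hasDerivWithinAt)
      (by simp [R, Finset.sum_range_succ'])
      hB
      (fun z hz => by
        simp only [R', norm_neg, Real.norm_eq_abs]
        exact ih z hz.1)
    exact key (right_mem_Icc.2 hx)

namespace GaussLaguerreConverges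

/-- Expand the extra factor `e^{-u/2}` by Taylor and bound `e^{-su}` by `1` in the error. The
majorant integrates to `k! (m+k choose k) 2^{-m}`, which tends to `0`; a full step of `1` in the
exponent would lose the geometric factor. -/
lemma pow_mul_exp_step {s : ℝ} (hs : 0 ≤ s)
    (h : ∀ k : ℕ, GaussLaguerreConverges fun u => u ^ k * Real.exp (-(s * u))) (k : ℕ) :
    GaussLaguerreConverges fun u => u ^ k * Real.exp (-((s + 1 / 2) * u)) := by
  refine of_approx (Continuous.continuousOn (by fun_prop)) fun ε hε => ?_
  have hsum : Tendsto (fun m : ℕ => (k.factorial : ℝ) * (((m + k).choose k : ℝ) * (1 / 2) ^ m))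
      atTop (𝓝 0) := by
    have : ‖(1 / 2 : ℝ)‖ < 1 := by norm_num
    simpa using ((summable_choose_mul_geometric_of_norm_lt_one k this).tendsto_atTop_zero).const_mul
      (k.factorial : ℝ)
  obtain ⟨m, hm⟩ := (hsum.eventually_lt_const hε).exists
  refine ⟨fun u => ∑ j ∈ Finset.range m, ((-1 / 2) ^ j / j.factorial) *
      (u ^ (k + j) * Real.exp (-(s * u))),
    fun u => (monomial (m + k) ((1 / 2 : ℝ) ^ m / m.factorial)).eval u,
    sum _ fun j _ => (h (k + j)).const_mul _, polynomial _, fun u hu => ?_, ?_⟩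
  · have hT := abs_exp_neg_sub_sum_le m (u / 2) (by positivity)
    have h1 : u ^ k * Real.exp (-((s + 1 / 2) * u)) - ∑ j ∈ Finset.range m,
        ((-1 / 2) ^ j / j.factorial) * (u ^ (k + j) * Real.exp (-(s * u))) =
        u ^ k * Real.exp (-(s * u)) * (Real.exp (-(u / 2)) -
          ∑ j ∈ Finset.range m, (-(u / 2)) ^ j / j.factorial) := by
      rw [mul_sub, Finset.mul_sum, mul_assoc, ← Real.exp_add]
      congr 1
      · ring_nf
      · refine Finset.sum_congr rfl fun j _ => ?_
        rw [show -(u / 2) = (-1 / 2) * u by ring, mul_pow, pow_add]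
        ring
    simp only [h1, eval_monomial]
    rw [abs_mul, abs_of_nonneg (by positivity)]
    calc u ^ k * Real.exp (-(s * u)) * |Real.exp (-(u / 2)) -
          ∑ j ∈ Finset.range m, (-(u / 2)) ^ j / j.factorial|
        ≤ u ^ k * 1 * ((u / 2) ^ m / m.factorial) := by
          gcongr
          exact Real.exp_le_one_iff.2 (by nlinarith)
      _ = (1 / 2) ^ m / m.factorial * u ^ (m + k) := by
          rw [pow_add, div_pow, div_pow, one_pow]
          ring
  · refine lt_of_eq_of_lt ?_ hm
    rw [← expMoment_apply, expMoment_monomial, ← Nat.add_choose_mul_factorial_mul_factorial m k,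
      ← Nat.choose_symm_add]
    have : (m.factorial : ℝ) ≠ 0 := by positivity
    push_cast
    field_simp

lemma pow_mul_exp_half_nat (n : ℕ) : ∀ k : ℕ,
    GaussLaguerreConverges fun u => u ^ k * Real.exp (-((n / 2 : ℝ) * u)) := by
  induction n with
  | zero => intro k; simpa using polynomial (X ^ k)
  | succ n ih =>
    have := pow_mul_exp_step (by positivity) ih
    simpa only [Nat.cast_succ, add_div] using this

lemma exp_neg_pow (n : ℕ) : GaussLaguerreConverges fun u => Real.exp (-u) ^ n := by
  have h := pow_mul_exp_half_nat (2 * n) 0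
  simp only [← Real.exp_nat_mul]
  convert! h using 2 with u
  push_cast
  rw [pow_zero, one_mul]
  congr 1
  ring

lemma eval_exp_neg (p : ℝ[X]) : GaussLaguerreConverges fun u => p.eval (Real.exp (-u)) := by
  simp only [eval_eq_sum_range]
  exact sum _ fun n _ => (exp_neg_pow n).const_mul _

/-- The Gauss-Laguerre formulas converge for every bounded continuous function. -/
lemma of_bounded {f : ℝ → ℝ} (hf : ContinuousOn f (Ici 0)) {M : ℝ}
    (hM : ∀ u, 0 ≤ u → |f u| ≤ M) : GaussLaguerreConverges f := by
  refine of_approx (hf.mono Ioi_subset_Ici_self) fun ε hε => ?_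
  have hM0 : 0 ≤ M := (abs_nonneg _).trans (hM 0 le_rfl)
  -- The final majorant `M δ u + δ` integrates to `(M + 1) δ = ε / 2`.
  set δ := ε / (2 * (M + 1)) with hδ
  have hδ0 : 0 < δ := by positivity
  -- Since `f` may have no limit at infinity, the damping `z ^ δ` is needed for continuity at `z =
  -- 0`; removing it costs `M (1 - e^{-δu}) ≤ M δ u`.
  let F : ℝ → ℝ := fun z => f (-Real.log z) * z ^ δ
  have hF : ContinuousOn F (Icc 0 1) := by
    intro z hz
    rcases hz.1.eq_or_lt with rfl | hz0
    · have h0 : F 0 = 0 := by simp [F, Real.zero_rpow hδ0.ne']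
      rw [ContinuousWithinAt, h0]
      have hlim : Tendsto (fun z : ℝ => M * z ^ δ) (𝓝[Icc 0 1] 0) (𝓝 0) := by
        have : ContinuousAt (fun z : ℝ => M * z ^ δ) 0 :=
          (Real.continuousAt_rpow_const 0 δ (Or.inr hδ0.le)).const_mul M
        simpa [ContinuousAt, Real.zero_rpow hδ0.ne'] using this.tendsto.mono_left (nhdsWithin_le_nhds (s := Icc 0 1))
      refine squeeze_zero_norm' ?_ hlim
      filter_upwards [self_mem_nhdsWithin] with x hx
      rw [norm_mul, Real.norm_eq_abs, Real.norm_eq_abs, abs_of_nonneg (Real.rpow_nonneg hx.1 δ)]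
      exact mul_le_mul_of_nonneg_right (hM _ (by linarith [Real.log_nonpos hx.1 hx.2]))
        (Real.rpow_nonneg hx.1 δ)
    · refine ContinuousWithinAt.mul ?_
        (Real.continuousAt_rpow_const z δ (Or.inl hz0.ne')).continuousWithinAt
      refine ContinuousWithinAt.comp (t := Ici 0)
        (hf _ (by simpa using Real.log_nonpos hz.1 hz.2))
        (Real.continuousAt_log hz0.ne').neg.continuousWithinAt fun x hx => ?_
      simpa using Real.log_nonpos hx.1 hx.2
  obtain ⟨p, hp⟩ := exists_polynomial_near_of_continuousOn 0 1 F hF δ hδ0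
  refine ⟨fun u => p.eval (Real.exp (-u)), fun u => (C (M * δ) * X + C δ).eval u,
    eval_exp_neg p, polynomial _, fun u hu => ?_, ?_⟩
  · have h1 := hp (Real.exp (-u)) ⟨(Real.exp_pos _).le, Real.exp_le_one_iff.2 (by linarith)⟩
    have h2 : F (Real.exp (-u)) = f u * Real.exp (-(δ * u)) := by
      simp only [F, Real.log_exp, neg_neg, ← Real.exp_mul]
      ring_nf
    rw [h2, abs_sub_comm] at h1
    have h3 : |f u - f u * Real.exp (-(δ * u))| ≤ M * (δ * u) := by
      rw [← mul_one_sub, abs_mul]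
      have he : 0 ≤ 1 - Real.exp (-(δ * u)) :=
        sub_nonneg.2 (Real.exp_le_one_iff.2 (by nlinarith))
      rw [abs_of_nonneg he]
      have := Real.add_one_le_exp (-(δ * u))
      exact mul_le_mul (hM u hu.le) (by linarith) he hM0
    have h4 := abs_sub_le (f u) (f u * Real.exp (-(δ * u))) (p.eval (Real.exp (-u)))
    simp only [eval_add, eval_mul, eval_C, eval_X]
    linarith
  · rw [← expMoment_apply]
    have h1 : expMoment (C (M * δ) * X + C δ) = M * δ + δ := by
      rw [map_add, C_mul_X_eq_monomial, ← monomial_zero_left, expMoment_monomial,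
        expMoment_monomial]
      simp
    rw [h1, hδ]
    field_simp
    linarith

end GaussLaguerreConverges

end LaguerreConvergence

/-! ### The diffusive representation of the Caputo derivative and bounds on its integrand. -/

section DiffusiveRepresentation

open Set

lemma image_exp_univ : Real.exp '' univ = Ioi 0 := by
  rw [image_univ, Real.range_exp]

lemma integrable_exp_mul_exp_neg_mul_exp {q s : ℝ} (hq : 0 < q) (hs : 0 < s) :
    Integrable fun w : ℝ => Real.exp (w * q) * Real.exp (-s * Real.exp w) := by
  have hint : IntegrableOn (fun v : ℝ => v ^ (q - 1) * Real.exp (-(s * v))) (Ioi 0) := by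
    -- The Bochner integral of a non-integrable function is `0`, so the positive Gamma value already
    -- gives integrability.
    refine Integrable.of_integral_ne_zero ?_
    rw [Real.integral_rpow_mul_exp_neg_mul_Ioi hq hs]
    have := Real.Gamma_pos_of_pos hq
    positivity
  rw [← image_exp_univ, integrableOn_image_iff_integrableOn_abs_deriv_smul MeasurableSet.univ
    (fun w _ => (Real.hasDerivAt_exp w).hasDerivWithinAt) Real.exp_injective.injOn,
    integrableOn_univ] at hint
  convert! hint using 2 with w
  rw [Real.abs_exp, smul_eq_mul, ← Real.exp_mul, ← Real.exp_add, ← Real.exp_add, ← Real.exp_add]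
  ring_nf

lemma integral_exp_mul_exp_neg_mul_exp {q s : ℝ} (hq : 0 < q) (hs : 0 < s) :
    ∫ w : ℝ, Real.exp (w * q) * Real.exp (-s * Real.exp w) = Real.Gamma q * s ^ (-q) := by
  have h := Real.integral_rpow_mul_exp_neg_mul_Ioi hq hs
  rw [← image_exp_univ, integral_image_eq_integral_abs_deriv_smul MeasurableSet.univ
    (fun w _ => (Real.hasDerivAt_exp w).hasDerivWithinAt) Real.exp_injective.injOn,
    setIntegral_univ] at h
  rw [Real.rpow_neg hs.le, mul_comm, ← Real.inv_rpow hs.le, ← one_div, ← h]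
  refine integral_congr_ae (ae_of_all _ fun w => ?_)
  simp only [Real.abs_exp, smul_eq_mul]
  rw [← Real.exp_mul, ← Real.exp_add, ← Real.exp_add, ← Real.exp_add]
  ring_nf

/-- The truncated Laplace transform `v ↦ ∫_a^t g(τ) e^{-(t - τ) v} dτ`. -/
noncomputable def truncatedLaplace (g : ℝ → ℝ) (a t v : ℝ) : ℝ :=
  ∫ τ in a..t, g τ * Real.exp (-(t - τ) * v)

lemma continuous_truncatedLaplace {g : ℝ → ℝ} (hg : Continuous g) (a t : ℝ) :
    Continuous (truncatedLaplace g a t) :=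
  intervalIntegral.continuous_parametric_intervalIntegral_of_continuous'
    (f := fun v τ => g τ * Real.exp (-(t - τ) * v)) (by fun_prop) a t

variable {g : ℝ → ℝ} {M a t q : ℝ}

lemma abs_truncatedLaplace_le (hM : ∀ τ, |g τ| ≤ M) (hat : a ≤ t) {v : ℝ} (hv : 0 ≤ v) :
    |truncatedLaplace g a t v| ≤ M * (t - a) := by
  rw [truncatedLaplace, ← Real.norm_eq_abs, ← abs_of_nonneg (sub_nonneg.2 hat)]
  refine intervalIntegral.norm_integral_le_of_norm_le_const fun τ hτ => ?_
  rw [uIoc_of_le hat] at hτ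
  rw [norm_mul, Real.norm_eq_abs, Real.norm_eq_abs, Real.abs_exp, ← mul_one M]
  refine mul_le_mul (hM τ) (Real.exp_le_one_iff.2 ?_) (Real.exp_pos _).le
    ((abs_nonneg _).trans (hM τ))
  nlinarith [hτ.2]

/-- This decay as `v → ∞` is what keeps `φ̂` bounded on the branch `w → +∞`. -/
lemma abs_truncatedLaplace_le_div (hM : ∀ τ, |g τ| ≤ M) (hat : a ≤ t) {v : ℝ}
    (hv : 0 < v) : |truncatedLaplace g a t v| ≤ M / v := by
  have hM0 : 0 ≤ M := (abs_nonneg _).trans (hM 0)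
  have hint : ∫ τ in a..t, M * Real.exp (-(t - τ) * v) =
      M / v * (1 - Real.exp (-(t - a) * v)) := by
    have hd : ∀ τ, HasDerivAt (fun τ => M / v * Real.exp (-(t - τ) * v))
        (M * Real.exp (-(t - τ) * v)) τ := by
      intro τ
      convert! ((((hasDerivAt_id τ).const_sub t).neg.mul_const v).exp).const_mul (M / v) using 1
      simp only [Pi.neg_apply, id]
      field_simp
    rw [intervalIntegral.integral_eq_sub_of_hasDerivAt (fun τ _ => hd τ)
      (Continuous.intervalIntegrable (by fun_prop) _ _)]
    simp
    ring
  have h1 : ‖truncatedLaplace g a t v‖ ≤ ∫ τ in a..t, M * Real.exp (-(t - τ) * v) := by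
    refine intervalIntegral.norm_integral_le_of_norm_le hat (ae_of_all _ fun τ _ => ?_)
      (Continuous.intervalIntegrable (by fun_prop) _ _)
    rw [norm_mul, Real.norm_eq_abs, Real.norm_eq_abs, Real.abs_exp]
    exact mul_le_mul_of_nonneg_right (hM τ) (Real.exp_pos _).le
  rw [← Real.norm_eq_abs]
  refine h1.trans (hint.trans_le ?_)
  have := Real.exp_pos (-(t - a) * v)
  exact mul_le_of_le_one_right (by positivity) (by linarith)

/-- This is the Fubini hypothesis: integrating the absolute value over `w` leaves at most `M Γ(q) (t
- τ)^{-q}`, integrable because `q < 1`. The null point `τ = t` is discarded. -/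
lemma integrable_prod_diffusive_kernel (hg : Continuous g) (hM : ∀ τ, |g τ| ≤ M)
    (hat : a ≤ t) (hq0 : 0 < q) (hq1 : q < 1) :
    Integrable (fun z : ℝ × ℝ =>
      g z.2 * (Real.exp (z.1 * q) * Real.exp (-(t - z.2) * Real.exp z.1)))
      (volume.prod (volume.restrict (Ioc a t))) := by
  have hlt : ∀ᵐ τ ∂(volume.restrict (Ioc a t)), τ < t := by
    rw [ae_restrict_iff' measurableSet_Ioc]
    filter_upwards [volume.ae_ne t] with τ hne hτ using lt_of_le_of_ne hτ.2 hne
  rw [integrable_prod_iff' (Continuous.aestronglyMeasurable (by fun_prop))]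
  constructor
  · filter_upwards [hlt] with τ hτ
    exact (integrable_exp_mul_exp_neg_mul_exp hq0 (sub_pos.2 hτ)).const_mul _
  · have hbase : IntegrableOn (fun τ => (t - τ) ^ (-q)) (Ioc a t) := by
      have h := (intervalIntegral.intervalIntegrable_rpow' (a := 0) (b := t - a) (r := -q)
        (by linarith)).comp_sub_left t
      simp only [sub_zero, sub_sub_cancel] at h
      exact (intervalIntegrable_iff_integrableOn_Ioc_of_le hat).1 h.symm
    have hdom : Integrable (fun τ => M * (Real.Gamma q * (t - τ) ^ (-q)))
        (volume.restrict (Ioc a t)) := (hbase.const_mul _).const_mul _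
    refine hdom.mono' ?_ ?_
    · exact (Continuous.aestronglyMeasurable (by fun_prop :
        Continuous fun z : ℝ × ℝ => ‖g z.1 *
          (Real.exp (z.2 * q) * Real.exp (-(t - z.1) * Real.exp z.2))‖)).integral_prod_right'
    · filter_upwards [hlt] with τ hτ
      rw [Real.norm_of_nonneg (integral_nonneg fun _ => norm_nonneg _)]
      simp only [norm_mul, Real.norm_eq_abs, Real.abs_exp]
      rw [integral_const_mul, integral_exp_mul_exp_neg_mul_exp hq0 (sub_pos.2 hτ)]
      have := Real.Gamma_pos_of_pos hq0
      have := Real.rpow_nonneg (sub_pos.2 hτ).le (-q)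
      exact mul_le_mul_of_nonneg_right (hM τ) (by positivity)

lemma exp_mul_truncatedLaplace_eq (hat : a ≤ t) (w : ℝ) :
    Real.exp (w * q) * truncatedLaplace g a t (Real.exp w) =
      ∫ τ in Ioc a t, g τ * (Real.exp (w * q) * Real.exp (-(t - τ) * Real.exp w)) := by
  rw [truncatedLaplace, intervalIntegral.integral_of_le hat, ← integral_const_mul]
  simp only [mul_left_comm]

lemma integrable_exp_mul_truncatedLaplace (hg : Continuous g) (hM : ∀ τ, |g τ| ≤ M)
    (hat : a ≤ t) (hq0 : 0 < q) (hq1 : q < 1) :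
    Integrable fun w => Real.exp (w * q) * truncatedLaplace g a t (Real.exp w) := by
  simp only [exp_mul_truncatedLaplace_eq hat]
  exact (integrable_prod_diffusive_kernel hg hM hat hq0 hq1).integral_prod_left

lemma integral_exp_mul_truncatedLaplace (hg : Continuous g) (hM : ∀ τ, |g τ| ≤ M)
    (hat : a ≤ t) (hq0 : 0 < q) (hq1 : q < 1) :
    ∫ w, Real.exp (w * q) * truncatedLaplace g a t (Real.exp w) =
      Real.Gamma q * ∫ τ in a..t, (t - τ) ^ (-q) * g τ := by
  simp only [exp_mul_truncatedLaplace_eq hat]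
  rw [integral_integral_swap (integrable_prod_diffusive_kernel hg hM hat hq0 hq1),
    intervalIntegral.integral_of_le hat, ← integral_const_mul]
  refine setIntegral_congr_ae measurableSet_Ioc ?_
  filter_upwards [volume.ae_ne t] with τ hne hτ
  rw [integral_const_mul,
    integral_exp_mul_exp_neg_mul_exp hq0 (sub_pos.2 (lt_of_le_of_ne hτ.2 hne))]
  ring

lemma integral_Ioi_split_scaled {Φ : ℝ → ℝ} (hΦ : Integrable Φ) {p r : ℝ} (hp : 0 < p)
    (hr : 0 < r) :
    ∫ u in Ioi (0 : ℝ), (1 / p * Φ (-u / p) + 1 / r * Φ (u / r)) = ∫ w, Φ w := by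
  obtain ⟨Ψ, hΨ⟩ : ∃ Ψ : ℝ → ℝ, ∀ w, Ψ w = Φ (-w) := ⟨_, fun _ => rfl⟩
  have hneg : Integrable Ψ := by
    simpa only [← hΨ] using hΦ.comp_neg
  have e1 : ∀ u, Φ (-u / p) = Ψ (p⁻¹ * u) := fun u => by
    rw [hΨ]
    congr 1
    ring
  have e2 : ∀ u, Φ (u / r) = Φ (r⁻¹ * u) := fun u => by rw [div_eq_inv_mul]
  simp only [e1, e2]
  have h1 : IntegrableOn (fun u => Ψ (p⁻¹ * u)) (Ioi 0) := by
    rw [integrableOn_Ioi_comp_mul_left_iff _ _ (inv_pos.2 hp)]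
    exact hneg.integrableOn
  have h2 : IntegrableOn (fun u => Φ (r⁻¹ * u)) (Ioi 0) := by
    rw [integrableOn_Ioi_comp_mul_left_iff _ _ (inv_pos.2 hr)]
    exact hΦ.integrableOn
  rw [integral_add (h1.const_mul _) (h2.const_mul _), integral_const_mul, integral_const_mul,
    integral_comp_mul_left_Ioi _ _ (inv_pos.2 hp), integral_comp_mul_left_Ioi _ _ (inv_pos.2 hr)]
  simp only [hΨ, integral_comp_neg_Ioi, mul_zero, neg_zero, smul_eq_mul, inv_inv, ← mul_assoc, one_div,
    inv_mul_cancel₀ hp.ne', inv_mul_cancel₀ hr.ne', one_mul]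
  exact intervalIntegral.integral_Iic_add_Ioi hΦ.integrableOn hΦ.integrableOn

/-- The top derivative is only known to be continuous on the interval; a constant extension beyond
the end points supplies the global hypotheses used above. -/
lemma exists_continuous_bounded_extension {g : ℝ → ℝ} (hat : a ≤ t)
    (hg : ContinuousOn g (Icc a t)) :
    ∃ (f : ℝ → ℝ) (M : ℝ), Continuous f ∧ (∀ τ, |f τ| ≤ M) ∧ EqOn g f (Icc a t) := by
  obtain ⟨M, hM⟩ := isCompact_Icc.exists_bound_of_continuousOn hg
  exact ⟨IccExtend hat ((Icc a t).domRestrict g), M,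
    (continuousOn_iff_continuous_domRestrict.1 hg).Icc_extend', fun τ => hM _ (projIcc a t hat τ).2,
    fun τ hτ => (IccExtend_of_mem hat ((Icc a t).domRestrict g) hτ).symm⟩

lemma natCeil_eq_natFloor_add_one {α : ℝ} (hα : 0 < α) (hαN : ∀ n : ℕ, α ≠ n) :
    ⌈α⌉₊ = ⌊α⌋₊ + 1 := by
  refine le_antisymm (Nat.ceil_le_floor_add_one α) (Nat.lt_ceil.2 ?_)
  exact lt_of_le_of_ne (Nat.floor_le hα.le) (hαN _).symm

lemma qD_pos {α : ℝ} (hα : 0 < α) : 0 < qD α := by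
  have := Nat.ceil_lt_add_one hα.le
  unfold qD
  linarith

lemma qD_lt_one {α : ℝ} (hαN : ∀ n : ℕ, α ≠ n) : qD α < 1 := by
  have := lt_of_le_of_ne (Nat.le_ceil α) (hαN _)
  unfold qD
  linarith

/-- As `α = q_D + ⌊α⌋`, the sign cancels against that of `sin(απ)`, leaving Euler's reflection
formula at `q_D`. -/
lemma diffusive_constant {α : ℝ} (hα : 0 < α) (hαN : ∀ n : ℕ, α ≠ n) :
    (-1) ^ ⌊α⌋₊ * (Real.sin (α * Real.pi) / Real.pi) * Real.Gamma (qD α) =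
      1 / Real.Gamma (⌈α⌉₊ - α) := by
  have hq0 := qD_pos hα
  have hq1 := qD_lt_one hαN
  have h1 : (⌈α⌉₊ : ℝ) - α = 1 - qD α := by unfold qD; ring
  have h2 : α * Real.pi = Real.pi * qD α + ⌊α⌋₊ * Real.pi := by
    rw [qD, natCeil_eq_natFloor_add_one hα hαN]
    push_cast
    ring
  have hrefl := Real.Gamma_mul_Gamma_one_sub (qD α)
  have hsin : 0 < Real.sin (Real.pi * qD α) :=
    Real.sin_pos_of_pos_of_lt_pi (by positivity) (by nlinarith [Real.pi_pos])
  have hG := Real.Gamma_pos_of_pos (sub_pos.2 hq1)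
  have hpow : ((-1 : ℝ) ^ ⌊α⌋₊) * (-1) ^ ⌊α⌋₊ = 1 := by rw [← mul_pow]; simp
  rw [h1, h2, Real.sin_add_nat_mul_pi, eq_div_iff hG.ne']
  have hπ := Real.pi_pos
  calc _ = ((-1 : ℝ) ^ ⌊α⌋₊ * (-1) ^ ⌊α⌋₊) * (Real.sin (Real.pi * qD α) / Real.pi) *
        (Real.Gamma (qD α) * Real.Gamma (1 - qD α)) := by ring
    _ = 1 := by
      rw [hpow, hrefl]
      field_simp

theorem theorem2 (a T α : ℝ) (hT : 0 < T) (hα : 0 < α) (hαN : ∀ n : ℕ, α ≠ n)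
    (y : ℝ → ℝ) (hy : ContDiffOn ℝ (⌈α⌉₊ : ℕ) y (Set.Icc a (a + T)))
    (t : ℝ) (ht : t ∈ Set.Icc a (a + T)) :
    Tendsto (fun K : ℕ => gaussLaguerre K (fun u => phiHat α a T y u t)) atTop
      (𝓝 (caputoDeriv α a T y t)) := by
  have hq0 := qD_pos hα
  have hq1 := qD_lt_one hαN
  have hr0 : 0 < 1 - qD α := sub_pos.2 hq1
  have hat : a ≤ t := ht.1
  have hcont : ContinuousOn (topDeriv α a T y) (Icc a t) :=
    (hy.continuousOn_iteratedDerivWithin le_rfl (uniqueDiffOn_Icc (by linarith))).mono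
      (Icc_subset_Icc_right ht.2)
  obtain ⟨g, M, hg, hM, hEq⟩ := exists_continuous_bounded_extension hat hcont
  set c : ℝ := (-1) ^ ⌊α⌋₊ * (Real.sin (α * Real.pi) / Real.pi) with hc
  let Φ : ℝ → ℝ := fun w => c * (Real.exp (w * qD α) * truncatedLaplace g a t (Real.exp w))
  have hphi : ∀ w, phiD α a T y w t = Φ w := by
    intro w
    simp only [phiD, Φ, truncatedLaplace, ← hc, mul_assoc]
    congr 2
    refine intervalIntegral.integral_congr fun τ hτ => ?_
    rw [uIcc_of_le hat] at hτ
    simp only [hEq hτ]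
  have hhat : ∀ u, phiHat α a T y u t =
      Real.exp u * (1 / qD α * Φ (-u / qD α) + 1 / (1 - qD α) * Φ (u / (1 - qD α))) := by
    intro u
    simp only [phiHat, hphi]
  have hΦ : Integrable Φ := (integrable_exp_mul_truncatedLaplace hg hM hat hq0 hq1).const_mul c
  have hΦc : Continuous Φ := by
    have := continuous_truncatedLaplace hg a t
    fun_prop
  have hint : ∫ u in Ioi (0 : ℝ), Real.exp (-u) * phiHat α a T y u t =
      caputoDeriv α a T y t := by
    have : ∀ u, Real.exp (-u) * phiHat α a T y u t =
        1 / qD α * Φ (-u / qD α) + 1 / (1 - qD α) * Φ (u / (1 - qD α)) := fun u => by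
      rw [hhat, ← mul_assoc, ← Real.exp_add, neg_add_cancel, Real.exp_zero, one_mul]
    simp only [this]
    rw [integral_Ioi_split_scaled hΦ hq0 hr0, integral_const_mul,
      integral_exp_mul_truncatedLaplace hg hM hat hq0 hq1, ← mul_assoc, hc,
      diffusive_constant hα hαN, caputoDeriv]
    congr 1
    refine intervalIntegral.integral_congr fun τ hτ => ?_
    rw [uIcc_of_le hat] at hτ
    simp only [hEq hτ]
    congr 2
    unfold qD
    ring
  have hbound : ∀ u, 0 ≤ u → |phiHat α a T y u t| ≤
      1 / qD α * (|c| * (M * (t - a))) + 1 / (1 - qD α) * (|c| * M) := by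
    intro u hu
    -- At `w = -u / q_D` the factor `e^{w q_D}` is `e^{-u}`, cancelling `e^u`.
    have h1 : Real.exp u * |Φ (-u / qD α)| ≤ |c| * (M * (t - a)) := by
      simp only [Φ, abs_mul, Real.abs_exp, div_mul_cancel₀ _ hq0.ne']
      calc _ = |c| * ((Real.exp u * Real.exp (-u)) *
            |truncatedLaplace g a t (Real.exp (-u / qD α))|) := by ring
        _ ≤ _ := by
          rw [← Real.exp_add, add_neg_cancel, Real.exp_zero, one_mul]
          exact mul_le_mul_of_nonneg_left
            (abs_truncatedLaplace_le hM hat (Real.exp_pos _).le) (abs_nonneg _)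
    -- At `w = u / (1 - q_D)` the exponentials combine to `e^w`, which the bound `M / e^w` absorbs.
    have h2 : Real.exp u * |Φ (u / (1 - qD α))| ≤ |c| * M := by
      simp only [Φ, abs_mul, Real.abs_exp]
      calc _ = |c| * ((Real.exp u * Real.exp (u / (1 - qD α) * qD α)) *
            |truncatedLaplace g a t (Real.exp (u / (1 - qD α)))|) := by ring
        _ ≤ |c| * (Real.exp (u / (1 - qD α)) * (M / Real.exp (u / (1 - qD α)))) := by
          have : u + u / (1 - qD α) * qD α = u / (1 - qD α) := by
            field_simp
            ring
          rw [← Real.exp_add, this]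
          have := abs_truncatedLaplace_le_div hM hat (Real.exp_pos (u / (1 - qD α)))
          gcongr
        _ = _ := by rw [mul_div_cancel₀ _ (Real.exp_ne_zero _)]
    rw [hhat, abs_mul, Real.abs_exp]
    calc _ ≤ Real.exp u * (|1 / qD α * Φ (-u / qD α)| + |1 / (1 - qD α) * Φ (u / (1 - qD α))|) :=
          mul_le_mul_of_nonneg_left (abs_add_le _ _) (Real.exp_pos _).le
      _ = 1 / qD α * (Real.exp u * |Φ (-u / qD α)|) +
          1 / (1 - qD α) * (Real.exp u * |Φ (u / (1 - qD α))|) := by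
        rw [abs_mul (1 / qD α), abs_mul (1 / (1 - qD α)), abs_of_pos (one_div_pos.2 hq0),
          abs_of_pos (one_div_pos.2 hr0)]
        ring
      _ ≤ _ := by gcongr
  rw [← hint]
  refine (GaussLaguerreConverges.of_bounded (Continuous.continuousOn ?_) hbound).2
  simp only [hhat]
  fun_prop

end DiffusiveRepresentation
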